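/- There is an absolute constant $c\ge 0$ such that the following holds. Let $X$ be a complex Banach space, let $\alpha\ge 0$, and let $T$ be a bounded linear operator on $X$ such that the set $$\mathcal{T} := \{(1+n)^{-\alpha}T^n : n\in\mathbb{Z},\ n\ge 0\}$$ is $\gamma$-bounded. Then, for every polynomial $f\in\mathbb{C}[z]$, $$\|f(T)\| \le c\, 9^{\alpha}\, \gamma(\mathcal{T})^2\, \|f\|_{\mathrm{B}^{2\alpha}_{\infty,1}(\mathbb{D})}.$$ Here a set $\mathcal{T}$ of bounded operators on $X$ is called $\gamma$-bounded if there is a constant $C\ge 0$ such that $$\mathbb{E}\Big(\Big\|\sum_{S\in\mathcal{T}'}\gamma_S\, S x_S\Big\|^2\Big)^{1/2} \le C\; \mathbb{E}\Big(\Big\|\sum_{S\in\mathcal{T}'}\gamma_S\, x_S\Big\|^2\Big)^{1/2}$$ for all finite subsets $\mathcal{T}'\subset\mathcal{T}$ and all families $(x_S)_{S\in\mathcal{T}'}$ in $X$, where $(\gamma_S)_{S\in\mathcal{T}'}$ are independent real standard Gaussian random variables; the smallest such $C$ is the $\gamma$-bound $\gamma(\mathcal{T})$. For $s\ge 0$ and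 $f(z)=\sum_{k\ge 0}a_kz^k$ analytic on the open unit disc $\mathbb{D}$, the Besov norm is $$\|f\|_{\mathrm{B}^{s}_{\infty,1}(\mathbb{D})} := \sum_{n=0}^\infty 2^{ns}\,\sup_{z\in\mathbb{D}}\Big|\sum_{k\ge 0}\varphi_n(k)\,a_k z^k\Big|,$$ where $\varphi_0:=(1,1,0,0,\dots)$ and, for $n\ge 1$, $\varphi_n(k) = 2^{-(n-1)}(k-2^{n-1})$ if $2^{n-1}\le k\le 2^n$, $\varphi_n(k)=2^{-n}(2^{n+1}-k)$ if $2^n\le k\le 2^{n+1}$, and $\varphi_n(k)=0$ otherwise. -/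

import Mathlib

open MeasureTheory ProbabilityTheory
open scoped ENNReal

noncomputable section

/-- `(𝔼 ‖∑ i, γ i • x i‖²)^(1/2)` for independent standard (real) Gaussian random variables
`γ i`, realised as the coordinates of the product Gaussian measure on `ι → ℝ`. -/
def gaussianSumNorm {ι X : Type*} [Fintype ι] [NormedAddCommGroup X] [NormedSpace ℂ X]
    (x : ι → X) : ℝ :=
  Real.sqrt (∫ g : ι → ℝ, ‖∑ i, ((g i : ℝ) : ℂ) • x i‖ ^ 2
    ∂(Measure.pi fun _ : ι => gaussianReal 0 1))

/-- `c ≥ 0` is an admissible constant in the definition of `γ`-boundedness of a set `𝒯` of bounded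
operators: the inequality is required for every finite subset `S` of `𝒯` and every family of
vectors indexed by `S`. -/
def IsGammaConstant {X Y : Type*} [NormedAddCommGroup X] [NormedSpace ℂ X]
    [NormedAddCommGroup Y] [NormedSpace ℂ Y] (𝒯 : Set (X →L[ℂ] Y)) (c : ℝ) : Prop :=
  0 ≤ c ∧ ∀ S : Finset (X →L[ℂ] Y), (S : Set (X →L[ℂ] Y)) ⊆ 𝒯 → ∀ x : S → X,
    gaussianSumNorm (fun A : S => (A : X →L[ℂ] Y) (x A)) ≤ c * gaussianSumNorm x

/-- A set of bounded operators is `γ`-bounded if it has an admissible constant. -/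
def IsGammaBounded {X Y : Type*} [NormedAddCommGroup X] [NormedSpace ℂ X]
    [NormedAddCommGroup Y] [NormedSpace ℂ Y] (𝒯 : Set (X →L[ℂ] Y)) : Prop :=
  ∃ c : ℝ, IsGammaConstant 𝒯 c

/-- The `γ`-bound of a `γ`-bounded set: the smallest admissible constant. -/
def gammaBound {X Y : Type*} [NormedAddCommGroup X] [NormedSpace ℂ X]
    [NormedAddCommGroup Y] [NormedSpace ℂ Y] (𝒯 : Set (X →L[ℂ] Y)) : ℝ :=
  sInf {c : ℝ | IsGammaConstant 𝒯 c}

/-- The dyadic partition of unity on the nonnegative integers. The `0`-th weight is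
`(1, 1, 0, 0, …)`; for `m ≥ 1` the `m`-th weight is supported in `[2^(m-1), 2^(m+1)]`, is `0` at the
endpoints, `1` at `2^m`, and linear in between. -/
def dyadicWeight : ℕ → ℕ → ℝ
  | 0, k => if k ≤ 1 then 1 else 0
  | n + 1, k =>
    if k ≤ 2 ^ n then 0
    else if k ≤ 2 ^ (n + 1) then ((k : ℝ) - 2 ^ n) / 2 ^ n
    else if k ≤ 2 ^ (n + 2) then (2 ^ (n + 2) - (k : ℝ)) / 2 ^ (n + 1)
    else 0

/-- The supremum norm over the open unit disc, with values in `[0, ∞]`. -/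
def discSupNorm (h : ℂ → ℂ) : ℝ≥0∞ :=
  ⨆ z ∈ Metric.ball (0 : ℂ) 1, ‖h z‖ₑ

/-- The `n`-th dyadic piece `z ↦ ∑ₖ φₙ(k) aₖ zᵏ` of the power series with coefficients `a`
(a finite sum, since the `n`-th dyadic weight has finite support). -/
def dyadicPiece (n : ℕ) (a : ℕ → ℂ) (z : ℂ) : ℂ :=
  ∑' k : ℕ, (dyadicWeight n k : ℂ) * a k * z ^ k

/-- The Besov norm of `B^s_{∞,1}(𝔻)` of the function with Taylor coefficients `a` at `0`,
with values in `[0, ∞]`. -/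
def besovENorm (s : ℝ) (a : ℕ → ℂ) : ℝ≥0∞ :=
  ∑' n : ℕ, ENNReal.ofReal ((2 : ℝ) ^ ((n : ℝ) * s)) * discSupNorm (dyadicPiece n a)

/-- The Besov norm as a real number, for functions in `B^s_{∞,1}(𝔻)` (that is, of finite
norm; all polynomials are such). -/
def besovNorm (s : ℝ) (a : ℕ → ℂ) : ℝ := (besovENorm s a).toReal

/-- The set `{(1 + n)^(-α) Tⁿ : n ≥ 0}`. -/
def scaledPowers {X : Type*} [NormedAddCommGroup X] [NormedSpace ℂ X] (T : X →L[ℂ] X)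
    (α : ℝ) : Set (X →L[ℂ] X) :=
  Set.range fun n : ℕ => (((1 + (n : ℝ)) ^ (-α) : ℝ) : ℂ) • T ^ n

end

-- Split `f` into its dyadic pieces; by the triangle inequality it suffices to bound `p(T)` for one
-- piece `p`, with frequencies of order `N`. Averaging over `N` ways of splitting each exponent
-- gives `N p(T) = ∑_{i<N} ∑_{j<L} p_{i+j+s} T^i T^{j+s}`, with `L` of order `N`. The matrix
-- `p_{i+j+s}` is a Hankel matrix, so its norm is at most `sup |p|` on the unit circle
-- (`norm_sum_coeff_mul_le`).
--
-- Write `T^n = (1+n)^α · (1+n)^{-α} T^n`. A Gaussian sum then passes through the right-hand powers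
-- by `γ`-boundedness, through the Hankel matrix by the ideal property
-- (`gaussianSumNorm_complex_matrix_le`), and through the left-hand powers by `γ`-boundedness again;
-- hence `γ(𝒯)²`. The weights `(1+n)^α` contribute two `ℓ²` norms, of total size about `N · N^{2α}`.
-- Dividing by `N` leaves `N^{2α} sup |p|`, which is the Besov weight of the piece.

local notation "γ[" ι "]" => Measure.pi (fun _ : ι => gaussianReal 0 1)

/-! ### Rotation invariance of the standard Gaussian law, via characteristic functions. -/

theorem charFunDual_gaussianReal_zero_one (L : StrongDual ℝ ℝ) :
    charFunDual (gaussianReal 0 1) L = Complex.exp (-((L 1 ^ 2 : ℝ) : ℂ) / 2) := by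
  have h (t : ℝ) : L t = L 1 * t := by
    have := L.map_smul t 1
    simpa [mul_comm] using this
  have h2 : charFunDual (gaussianReal 0 1) L = charFun (gaussianReal 0 1) (L 1) := by
    rw [charFunDual_apply, charFun_apply_real]
    refine integral_congr_ae (.of_forall fun t => ?_)
    simp only [h t, Complex.ofReal_mul]
  rw [h2, charFun_gaussianReal]
  simp [neg_div]

theorem charFunDual_pi_gaussianReal {ι : Type*} [Fintype ι] [DecidableEq ι]
    (L : StrongDual ℝ (ι → ℝ)) :
    charFunDual γ[ι] L = Complex.exp (-((∑ i, L (Pi.single i 1) ^ 2 : ℝ) : ℂ) / 2) := by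
  rw [charFunDual_pi]
  simp_rw [charFunDual_gaussianReal_zero_one]
  rw [← Complex.exp_sum]
  congr 1
  simp [Finset.sum_div, neg_div]

/-- The law of `Cᵀ g` is standard Gaussian if `Cᵀ C = 1`. -/
theorem map_transpose_mulVec_pi_gaussianReal {ι κ : Type*} [Fintype ι] [Fintype κ] [DecidableEq κ]
    (C : Matrix ι κ ℝ) (hC : C.transpose * C = 1) :
    γ[ι].map (fun g => C.transpose.mulVec g) = γ[κ] := by
  classical
  let A : (ι → ℝ) →L[ℝ] (κ → ℝ) := C.transpose.mulVecLin.toContinuousLinearMap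
  change γ[ι].map A = _
  refine Measure.ext_of_charFunDual (funext fun L => ?_)
  rw [charFunDual_map, charFunDual_pi_gaussianReal, charFunDual_pi_gaussianReal]
  set l : κ → ℝ := fun j => L (Pi.single j 1) with hl
  have hL (v : κ → ℝ) : L v = v ⬝ᵥ l := by
    conv_lhs => rw [pi_eq_sum_univ' v]
    simp [dotProduct, hl]
  have h (i : ι) : (L.comp A) (Pi.single i 1) = C.mulVec l i := by
    change L (C.transpose.mulVec _) = _
    rw [hL, Matrix.mulVec_single_one]
    rfl
  have h2 : ∑ i, (C.mulVec l i) ^ 2 = ∑ j, l j ^ 2 := by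
    have : C.mulVec l ⬝ᵥ C.mulVec l = l ⬝ᵥ l := by
      rw [Matrix.dotProduct_mulVec, Matrix.vecMul_mulVec, hC, Matrix.vecMul_one]
    simpa [dotProduct, sq] using this
  simp_rw [h, h2, hl]

/-! ### Gaussian sums and their ideal property. -/

section
variable {ι κ X : Type*} [Fintype ι] [Fintype κ] [NormedAddCommGroup X] [NormedSpace ℂ X]

theorem gaussianSumNorm_nonneg (x : ι → X) : 0 ≤ gaussianSumNorm x := Real.sqrt_nonneg _

theorem sq_gaussianSumNorm (x : ι → X) :
    gaussianSumNorm x ^ 2 = ∫ g : ι → ℝ, ‖∑ i, ((g i : ℝ) : ℂ) • x i‖ ^ 2 ∂γ[ι] :=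
  Real.sq_sqrt (integral_nonneg fun _ => by positivity)

theorem continuous_gaussianSum (x : ι → X) :
    Continuous fun g : ι → ℝ => ∑ i, ((g i : ℝ) : ℂ) • x i := by fun_prop

theorem integrable_sq_norm_gaussianSum (x : ι → X) :
    Integrable (fun g : ι → ℝ => ‖∑ i, ((g i : ℝ) : ℂ) • x i‖ ^ 2) γ[ι] := by
  have hm : MemLp (fun g : ι → ℝ => ∑ i, |g i| * ‖x i‖) 2 γ[ι] := by
    refine memLp_finsetSum _ fun i _ => ?_
    refine MemLp.mul_const ?_ _
    have h1 : MemLp (fun g : ι → ℝ => g i) 2 γ[ι] :=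
      (memLp_id_gaussianReal' 2 (by simp)).comp_measurePreserving
        (measurePreserving_eval (fun _ : ι => gaussianReal 0 1) i)
    exact h1.norm
  refine hm.integrable_sq.mono' ((continuous_gaussianSum x).norm.pow 2).aestronglyMeasurable (.of_forall fun g => ?_)
  rw [Real.norm_of_nonneg (by positivity)]
  gcongr
  refine (norm_sum_le _ _).trans_eq (Finset.sum_congr rfl fun i _ => ?_)
  simp [norm_smul]

theorem gaussianSumNorm_isometry [DecidableEq κ] (C : Matrix ι κ ℝ) (hC : C.transpose * C = 1)
    (x : κ → X) : gaussianSumNorm (fun i => ∑ j, (C i j : ℂ) • x j) = gaussianSumNorm x := by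
  unfold gaussianSumNorm
  congr 1
  rw [← map_transpose_mulVec_pi_gaussianReal C hC, integral_map]
  · refine integral_congr_ae (.of_forall fun g => ?_)
    simp only [Matrix.mulVec, dotProduct, Matrix.transpose_apply, Complex.ofReal_sum,
      Finset.sum_smul, Finset.smul_sum]
    rw [Finset.sum_comm]
    simp [-Complex.coe_smul, smul_smul, mul_comm]
  · exact (Continuous.matrix_mulVec continuous_const continuous_id).aemeasurable
  · exact ((continuous_gaussianSum x).norm.pow 2).aestronglyMeasurable

/-- A substitute for Minkowski's inequality, from `‖u + v‖² ≤ 2‖u‖² + 2‖v‖²`. Nothing is lost when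
`a = b`, the only case used. -/
theorem gaussianSumNorm_add_le (x y : ι → X) {a b c : ℝ} (hc : 0 ≤ c)
    (hx : gaussianSumNorm x ≤ a) (hy : gaussianSumNorm y ≤ b) (h : 2 * a ^ 2 + 2 * b ^ 2 ≤ c ^ 2) :
    gaussianSumNorm (fun i => x i + y i) ≤ c := by
  refine le_of_sq_le_sq ?_ hc
  have hx2 := pow_le_pow_left₀ (gaussianSumNorm_nonneg x) hx 2
  have hy2 := pow_le_pow_left₀ (gaussianSumNorm_nonneg y) hy 2
  rw [sq_gaussianSumNorm] at *
  have : ∫ g : ι → ℝ, ‖∑ i, ((g i : ℝ) : ℂ) • (x i + y i)‖ ^ 2 ∂γ[ι] ≤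
      ∫ g : ι → ℝ, (2 * ‖∑ i, ((g i : ℝ) : ℂ) • x i‖ ^ 2 +
        2 * ‖∑ i, ((g i : ℝ) : ℂ) • y i‖ ^ 2) ∂γ[ι] := by
    refine integral_mono (integrable_sq_norm_gaussianSum _)
      (((integrable_sq_norm_gaussianSum x).const_mul 2).add
        ((integrable_sq_norm_gaussianSum y).const_mul 2)) fun g => ?_
    simp only [smul_add, Finset.sum_add_distrib]
    have := norm_add_le (∑ i, ((g i : ℝ) : ℂ) • x i) (∑ i, ((g i : ℝ) : ℂ) • y i)
    nlinarith [norm_nonneg (∑ i, ((g i : ℝ) : ℂ) • x i + ∑ i, ((g i : ℝ) : ℂ) • y i),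
      sq_nonneg (‖∑ i, ((g i : ℝ) : ℂ) • x i‖ - ‖∑ i, ((g i : ℝ) : ℂ) • y i‖)]
  rw [integral_add ((integrable_sq_norm_gaussianSum x).const_mul 2)
        ((integrable_sq_norm_gaussianSum y).const_mul 2), integral_const_mul,
        integral_const_mul] at this
  linarith

theorem gaussianSumNorm_const_smul (c : ℂ) (x : ι → X) :
    gaussianSumNorm (fun i => c • x i) = ‖c‖ * gaussianSumNorm x := by
  unfold gaussianSumNorm
  simp_rw [smul_comm _ c, ← Finset.smul_sum, norm_smul, mul_pow]
  rw [integral_const_mul, Real.sqrt_mul (by positivity), Real.sqrt_sq (norm_nonneg _)]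

theorem gaussianSumNorm_unit (x : X) : gaussianSumNorm (fun _ : Unit => x) = ‖x‖ := by
  have h : ∫ g : ℝ, g ^ 2 ∂gaussianReal 0 1 = 1 := by
    have := variance_id_gaussianReal (μ := 0) (v := 1)
    rw [variance_of_integral_eq_zero (by fun_prop) (by simp)] at this
    simpa using this
  unfold gaussianSumNorm
  simp only [Finset.univ_unique, Finset.sum_singleton, norm_smul, Complex.norm_real, mul_pow,
    Real.norm_eq_abs, sq_abs]
  rw [integral_mul_const]
  have h2 := (measurePreserving_eval (fun _ : Unit => gaussianReal 0 1) default).integral_comp'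
    (f := MeasurableEquiv.funUnique Unit ℝ) (g := fun t => t ^ 2)
  rw [show (∫ g : Unit → ℝ, g default ^ 2 ∂γ[Unit]) = 1 from h2.trans h]
  simp [Real.sqrt_sq]

/-- The real ideal property of Gaussian sums, for contractive matrices. -/
theorem gaussianSumNorm_contraction_le (P : Matrix ι κ ℝ)
    (hP : ∀ η : κ → ℝ, ∑ i, P.mulVec η i ^ 2 ≤ ∑ j, η j ^ 2) (x : κ → X) :
    gaussianSumNorm (fun i => ∑ j, (P i j : ℂ) • x j) ≤ gaussianSumNorm x := by
  classical
  -- Stacking `P` on `B`, a root of `1 - PᵀP`, gives orthonormal columns, and so does stacking `P`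
  -- on `-B`. Averaging over the two signs removes the `B` part by convexity of the squared norm.
  obtain ⟨B, hB⟩ : ∃ B : Matrix κ κ ℝ, P.transpose * P + B.transpose * B = 1 := by
    have hpos : (1 - P.transpose * P).PosSemidef := by
      refine .of_dotProduct_mulVec_nonneg ?_ fun η => ?_
      · simp [Matrix.IsHermitian, Matrix.conjTranspose_eq_transpose_of_trivial,
          Matrix.transpose_mul]
      · have h := hP η
        have h1 : η ⬝ᵥ (P.transpose * P).mulVec η = ∑ i, P.mulVec η i ^ 2 := by
          rw [← Matrix.mulVec_mulVec, Matrix.dotProduct_mulVec, Matrix.vecMul_transpose]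
          simp [dotProduct, sq]
        have h2 : η ⬝ᵥ η = ∑ i, η i ^ 2 := by simp [dotProduct, sq]
        rw [Matrix.sub_mulVec, dotProduct_sub, Matrix.one_mulVec]
        simp only [star_trivial]
        rw [h1, h2]
        linarith
    open scoped MatrixOrder in
    obtain ⟨B, hB⟩ := CStarAlgebra.nonneg_iff_eq_star_mul_self.1 hpos.nonneg
    refine ⟨B, ?_⟩
    rw [Matrix.star_eq_conjTranspose, Matrix.conjTranspose_eq_transpose_of_trivial] at hB
    rw [← hB]; abel
  set a : ι → X := fun i => ∑ j, (P i j : ℂ) • x j with ha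
  set b : κ → X := fun i => ∑ j, (B i j : ℂ) • x j with hb
  have e1 : gaussianSumNorm (Sum.elim a b) = gaussianSumNorm x := by
    rw [← gaussianSumNorm_isometry (Matrix.fromRows P B) (by
      rw [Matrix.transpose_fromRows, Matrix.fromCols_mul_fromRows, hB])]
    congr 1
    ext (i | i) <;> simp [ha, hb]
  have e2 : gaussianSumNorm (Sum.elim a (fun i => - b i)) = gaussianSumNorm x := by
    rw [← gaussianSumNorm_isometry (Matrix.fromRows P (-B)) (by
      rw [Matrix.transpose_fromRows, Matrix.fromCols_mul_fromRows]; simpa using hB)]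
    congr 1
    ext (i | i) <;> simp [ha, hb]
  -- Padding by zeros puts both sides over the same Gaussian space.
  have e3 : gaussianSumNorm (Sum.elim a (fun _ : κ => (0 : X))) = gaussianSumNorm a := by
    rw [← gaussianSumNorm_isometry (Matrix.fromRows 1 0 : Matrix (ι ⊕ κ) ι ℝ) (by
      rw [Matrix.transpose_fromRows, Matrix.fromCols_mul_fromRows]; simp)]
    congr 1
    ext (i | i) <;> simp [Matrix.one_apply]
  rw [← e3]
  refine le_of_sq_le_sq ?_ (gaussianSumNorm_nonneg x)
  have : ∫ g, ‖∑ i, ((g i : ℝ) : ℂ) • (Sum.elim a (fun _ : κ => (0 : X))) i‖ ^ 2 ∂γ[ι ⊕ κ] ≤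
      ∫ g, (‖∑ i, ((g i : ℝ) : ℂ) • (Sum.elim a b) i‖ ^ 2 / 2 +
        ‖∑ i, ((g i : ℝ) : ℂ) • (Sum.elim a (fun i => - b i)) i‖ ^ 2 / 2) ∂γ[ι ⊕ κ] := by
    refine integral_mono (integrable_sq_norm_gaussianSum _)
      (((integrable_sq_norm_gaussianSum _).div_const 2).add
        ((integrable_sq_norm_gaussianSum _).div_const 2)) fun g => ?_
    simp only [Fintype.sum_sum_type, Sum.elim_inl, Sum.elim_inr, smul_zero,
      Finset.sum_const_zero, add_zero, smul_neg, Finset.sum_neg_distrib]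
    set u := ∑ i, ((g (Sum.inl i) : ℝ) : ℂ) • a i
    set v := ∑ i, ((g (Sum.inr i) : ℝ) : ℂ) • b i
    have h : ‖u + u‖ ≤ ‖u + v‖ + ‖u + -v‖ := by
      refine le_trans (le_of_eq ?_) (norm_add_le _ _)
      congr 1; abel
    have h' : ‖u + u‖ = 2 * ‖u‖ := by rw [← two_smul ℂ, norm_smul]; simp
    nlinarith [norm_nonneg u, sq_nonneg (‖u + v‖ - ‖u + -v‖)]
  rw [integral_add ((integrable_sq_norm_gaussianSum _).div_const 2)
    ((integrable_sq_norm_gaussianSum _).div_const 2), integral_div, integral_div,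
    ← sq_gaussianSumNorm, ← sq_gaussianSumNorm, ← sq_gaussianSumNorm, e1, e2] at this
  linarith

theorem gaussianSumNorm_matrix_le (P : Matrix ι κ ℝ) {K : ℝ} (hK : 0 ≤ K)
    (hP : ∀ η : κ → ℝ, ∑ i, P.mulVec η i ^ 2 ≤ K ^ 2 * ∑ j, η j ^ 2) (x : κ → X) :
    gaussianSumNorm (fun i => ∑ j, (P i j : ℂ) • x j) ≤ K * gaussianSumNorm x := by
  rcases hK.eq_or_lt with rfl | hK
  · have h0 : P = 0 := by
      classical
      ext i j
      have h1 := hP (Pi.single j 1)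
      rw [Matrix.mulVec_single_one] at h1
      have h2 := Finset.single_le_sum (f := fun i => P.col j i ^ 2) (fun i _ => sq_nonneg _)
        (Finset.mem_univ i)
      have h3 : P i j ^ 2 ≤ 0 := by
        refine h2.trans (h1.trans ?_); simp
      simpa using le_antisymm h3 (sq_nonneg _)
    simp [h0, gaussianSumNorm]
  · have h := gaussianSumNorm_contraction_le (K⁻¹ • P) (fun η => by
      simp only [Matrix.smul_mulVec, Pi.smul_apply, smul_eq_mul, mul_pow, ← Finset.mul_sum]
      rw [inv_pow, inv_mul_le_iff₀ (by positivity)]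
      exact hP η) x
    have e : (fun i => ∑ j, ((K⁻¹ • P) i j : ℂ) • x j) =
        fun i => ((K⁻¹ : ℝ) : ℂ) • ∑ j, (P i j : ℂ) • x j := by
      ext i
      simp [-Complex.coe_smul, Finset.smul_sum, smul_smul]
    rw [e, gaussianSumNorm_const_smul] at h
    rw [Complex.norm_real, Real.norm_of_nonneg (by positivity), inv_mul_le_iff₀ hK] at h
    exact h

theorem gaussianSumNorm_smul_le (v : ι → ℝ) (x : X) :
    gaussianSumNorm (fun i => (v i : ℂ) • x) ≤ Real.sqrt (∑ i, v i ^ 2) * ‖x‖ := by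
  have h := gaussianSumNorm_matrix_le (Matrix.of fun i (_ : Unit) => v i)
    (Real.sqrt_nonneg (∑ i, v i ^ 2)) (fun η => ?_) (fun _ => x)
  · rw [gaussianSumNorm_unit] at h
    simpa using h
  · rw [Real.sq_sqrt (by positivity)]
    simp [Matrix.mulVec, dotProduct, mul_pow, Finset.sum_mul]

theorem norm_sum_smul_le_gaussianSumNorm (v : ι → ℝ) (x : ι → X) :
    ‖∑ i, (v i : ℂ) • x i‖ ≤ Real.sqrt (∑ i, v i ^ 2) * gaussianSumNorm x := by
  have h := gaussianSumNorm_matrix_le (Matrix.of fun (_ : Unit) i => v i)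
    (Real.sqrt_nonneg (∑ i, v i ^ 2)) (fun η => ?_) x
  · rw [← gaussianSumNorm_unit (∑ i, (v i : ℂ) • x i)]
    simpa using h
  · rw [Real.sq_sqrt (by positivity)]
    simpa [Matrix.mulVec, dotProduct] using Finset.sum_mul_sq_le_sq_mul_sq Finset.univ v η

/-- The ideal property of Gaussian sums for complex matrices which are bounded as bilinear forms
on real vectors. -/
theorem gaussianSumNorm_complex_matrix_le (M : ι → κ → ℂ) {K : ℝ} (hK : 0 ≤ K)
    (hM : ∀ (ξ : ι → ℝ) (η : κ → ℝ), ‖∑ i, ∑ j, M i j * ξ i * η j‖ ≤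
      K * Real.sqrt (∑ i, ξ i ^ 2) * Real.sqrt (∑ j, η j ^ 2)) (x : κ → X) :
    gaussianSumNorm (fun i => ∑ j, M i j • x j) ≤ 2 * K * gaussianSumNorm x := by
  have key (P : Matrix ι κ ℝ) (hPM : ∀ (ξ : ι → ℝ) (η : κ → ℝ),
      |∑ i, ∑ j, P i j * ξ i * η j| ≤ ‖∑ i, ∑ j, M i j * ξ i * η j‖) (η : κ → ℝ) :
      ∑ i, P.mulVec η i ^ 2 ≤ K ^ 2 * ∑ j, η j ^ 2 := by
    set s := ∑ i, P.mulVec η i ^ 2 with hs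
    have h1 : ∑ i, ∑ j, P i j * P.mulVec η i * η j = s := by
      rw [hs]
      refine Finset.sum_congr rfl fun i _ => ?_
      rw [sq]
      nth_rw 2 [Matrix.mulVec]
      rw [dotProduct, Finset.sum_mul]
      exact Finset.sum_congr rfl fun j _ => by ring
    have hs0 : 0 ≤ s := Finset.sum_nonneg fun _ _ => sq_nonneg _
    -- Testing the form at `ξ = Pη` gives `s ≤ K √s t`; then `√s` cancels.
    have h2 := (hPM (P.mulVec η) η).trans (hM _ _)
    rw [h1, abs_of_nonneg hs0, ← hs] at h2
    set t := Real.sqrt (∑ j, η j ^ 2) with ht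
    have ht2 : t ^ 2 = ∑ j, η j ^ 2 := Real.sq_sqrt (by positivity)
    rw [← ht2]
    have hr2 : Real.sqrt s ^ 2 = s := Real.sq_sqrt hs0
    rcases (Real.sqrt_nonneg s).eq_or_lt with h0 | h0
    · rw [(Real.sqrt_eq_zero hs0).1 h0.symm]; positivity
    · have : Real.sqrt s ≤ K * t := by
        refine le_of_mul_le_mul_right ?_ h0
        nlinarith
      rw [← hr2, ← mul_pow]
      gcongr
  have hre := gaussianSumNorm_matrix_le (Matrix.of fun i j => (M i j).re) hK (key _ fun ξ η => by
    refine le_trans (le_of_eq ?_) (Complex.abs_re_le_norm _)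
    simp) x
  have him := gaussianSumNorm_matrix_le (Matrix.of fun i j => (M i j).im) hK (key _ fun ξ η => by
    refine le_trans (le_of_eq ?_) (Complex.abs_im_le_norm _)
    simp) x
  have e : (fun i => ∑ j, M i j • x j) = fun i => (∑ j, ((M i j).re : ℂ) • x j) +
      Complex.I • ∑ j, ((M i j).im : ℂ) • x j := by
    ext i
    rw [Finset.smul_sum, ← Finset.sum_add_distrib]
    refine Finset.sum_congr rfl fun j _ => ?_
    rw [smul_smul, ← add_smul, mul_comm Complex.I, Complex.re_add_im]
  rw [e]
  have h0 := gaussianSumNorm_nonneg x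
  refine gaussianSumNorm_add_le _ _ (by positivity) hre
    (b := K * gaussianSumNorm x)
    (by rw [gaussianSumNorm_const_smul, Complex.norm_I, one_mul]; exact him) (le_of_eq ?_)
  ring

end

/-! ### Consequences of `γ`-boundedness for weighted double sums. -/

theorem IsGammaBounded.isGammaConstant_gammaBound {X Y : Type*} [NormedAddCommGroup X]
    [NormedSpace ℂ X] [NormedAddCommGroup Y] [NormedSpace ℂ Y] {𝒯 : Set (X →L[ℂ] Y)}
    (h : IsGammaBounded 𝒯) : IsGammaConstant 𝒯 (gammaBound 𝒯) := by
  have hne : {c : ℝ | IsGammaConstant 𝒯 c}.Nonempty := h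
  refine ⟨le_csInf hne fun c hc => hc.1, fun S hS x => ?_⟩
  -- The infimum is attained by dividing by the Gaussian norm, so a vanishing norm needs its own
  -- case.
  rcases (gaussianSumNorm_nonneg x).eq_or_lt with h0 | h0
  · obtain ⟨c, hc⟩ := h
    simpa [← h0] using hc.2 S hS x
  · rw [← div_le_iff₀ h0]
    exact le_csInf hne fun c hc => (div_le_iff₀ h0).2 (hc.2 S hS x)

section
variable {X : Type*} [NormedAddCommGroup X] [NormedSpace ℂ X]

/-- The core chain: `d` and `e` pair a Gaussian sum with a vector on either side, and between them
come `γ`-bound, matrix, `γ`-bound. -/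
theorem IsGammaConstant.norm_sum_comp_le {𝒯 : Set (X →L[ℂ] X)} {γ : ℝ} (hγ : IsGammaConstant 𝒯 γ)
    (S : Finset (X →L[ℂ] X)) (hS : (S : Set (X →L[ℂ] X)) ⊆ 𝒯) (d e : S → ℝ) (M : S → S → ℂ)
    {K : ℝ} (hK : 0 ≤ K)
    (hM : ∀ ξ η : S → ℝ, ‖∑ A, ∑ B, M A B * ξ A * η B‖ ≤
      K * Real.sqrt (∑ A, ξ A ^ 2) * Real.sqrt (∑ B, η B ^ 2)) (x : X) :
    ‖∑ A : S, (d A : ℂ) • (A : X →L[ℂ] X) (∑ B : S, M A B • (B : X →L[ℂ] X) ((e B : ℂ) • x))‖ ≤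
      2 * γ ^ 2 * K * Real.sqrt (∑ A, d A ^ 2) * Real.sqrt (∑ B, e B ^ 2) * ‖x‖ := by
  have h0 := hγ.1
  have h1 := norm_sum_smul_le_gaussianSumNorm d fun A : S =>
    (A : X →L[ℂ] X) (∑ B : S, M A B • (B : X →L[ℂ] X) ((e B : ℂ) • x))
  have h2 := hγ.2 S hS fun A : S => ∑ B : S, M A B • (B : X →L[ℂ] X) ((e B : ℂ) • x)
  have h3 := gaussianSumNorm_complex_matrix_le M hK hM fun B : S =>
    (B : X →L[ℂ] X) ((e B : ℂ) • x)
  have h4 := hγ.2 S hS fun B : S => (e B : ℂ) • x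
  have h5 := gaussianSumNorm_smul_le e x
  calc _ ≤ _ := h1
    _ ≤ Real.sqrt (∑ A, d A ^ 2) * (γ * (2 * K * (γ * (Real.sqrt (∑ B, e B ^ 2) * ‖x‖)))) := by
      gcongr
      refine h2.trans ?_
      gcongr
      refine h3.trans ?_
      gcongr
      refine h4.trans ?_
      gcongr
    _ = _ := by ring

/-- Collapsing a family along `σ`: the normalised fibre weights act contractively. -/
theorem sum_sq_fiberwise_le {ι S : Type*} [Fintype ι] [Fintype S] [DecidableEq S] (σ : ι → S)
    (u : ι → ℝ) (ξ : S → ℝ) :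
    ∑ i, (u i / Real.sqrt (∑ k with σ k = σ i, u k ^ 2) * ξ (σ i)) ^ 2 ≤ ∑ A, ξ A ^ 2 := by
  rw [← Finset.sum_fiberwise (s := Finset.univ) (g := σ)]
  refine Finset.sum_le_sum fun A _ => ?_
  set D := ∑ k with σ k = A, u k ^ 2 with hD
  have hD0 : 0 ≤ D := Finset.sum_nonneg fun _ _ => sq_nonneg _
  have : ∑ i with σ i = A, (u i / Real.sqrt (∑ k with σ k = σ i, u k ^ 2) * ξ (σ i)) ^ 2 =
      D / D * ξ A ^ 2 := by
    rw [hD, Finset.sum_div, Finset.sum_mul, ← hD]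
    refine Finset.sum_congr rfl fun i hi => ?_
    rw [(Finset.mem_filter.1 hi).2, mul_pow, div_pow, ← hD, Real.sq_sqrt hD0]
  rw [this]
  exact mul_le_of_le_one_left (sq_nonneg _) (div_self_le_one D)

theorem sum_sum_fiberwise {ι κ S E : Type*} [Fintype ι] [Fintype κ] [Fintype S] [DecidableEq S]
    [AddCommMonoid E] (σ : ι → S) (τ : κ → S) (F : S → S → ι → κ → E) :
    ∑ A, ∑ B, ∑ i with σ i = A, ∑ j with τ j = B, F A B i j = ∑ i, ∑ j, F (σ i) (τ j) i j := by
  have step (A : S) : ∑ B, ∑ i with σ i = A, ∑ j with τ j = B, F A B i j =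
      ∑ i with σ i = A, ∑ j, F (σ i) (τ j) i j := by
    rw [Finset.sum_comm]
    refine Finset.sum_congr rfl fun i hi => ?_
    rw [← Finset.sum_fiberwise (s := Finset.univ) (g := τ)]
    refine Finset.sum_congr rfl fun B _ => Finset.sum_congr rfl fun j hj => ?_
    rw [(Finset.mem_filter.1 hi).2, (Finset.mem_filter.1 hj).2]
  simp_rw [step]
  exact Finset.sum_fiberwise _ _ _

/-- `γ`-bounded families, possibly with repetitions, applied in both factors of a weighted double
sum. -/
theorem IsGammaConstant.norm_sum_sum_le {𝒯 : Set (X →L[ℂ] X)} {γ : ℝ} (hγ : IsGammaConstant 𝒯 γ)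
    {ι κ : Type*} [Fintype ι] [Fintype κ] (s : ι → X →L[ℂ] X) (t : κ → X →L[ℂ] X)
    (hs : ∀ i, s i ∈ 𝒯) (ht : ∀ j, t j ∈ 𝒯) (u : ι → ℝ) (v : κ → ℝ) (h : ι → κ → ℂ)
    {K : ℝ} (hK : 0 ≤ K)
    (hh : ∀ (ξ : ι → ℝ) (η : κ → ℝ), ‖∑ i, ∑ j, h i j * ξ i * η j‖ ≤
      K * Real.sqrt (∑ i, ξ i ^ 2) * Real.sqrt (∑ j, η j ^ 2)) :
    ‖∑ i, ∑ j, (h i j * u i * v j) • (s i * t j)‖ ≤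
      2 * γ ^ 2 * K * Real.sqrt (∑ i, u i ^ 2) * Real.sqrt (∑ j, v j ^ 2) := by
  classical
  have hγ0 := hγ.1
  refine ContinuousLinearMap.opNorm_le_bound _ (by positivity) fun x => ?_
  -- `γ`-boundedness speaks of sets, while powers of `T` may coincide. Equal operators are therefore
  -- merged, each carrying the `ℓ²` norm of its weights.
  let S : Finset (X →L[ℂ] X) := Finset.univ.image s ∪ Finset.univ.image t
  have hS : (S : Set (X →L[ℂ] X)) ⊆ 𝒯 := by
    intro A hA
    simp only [S, Finset.coe_union, Finset.coe_image, Finset.coe_univ, Set.image_univ,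
      Set.mem_union, Set.mem_range] at hA
    rcases hA with ⟨i, rfl⟩ | ⟨j, rfl⟩
    exacts [hs i, ht j]
  let σ : ι → S := fun i => ⟨s i, by simp [S]⟩
  let τ : κ → S := fun j => ⟨t j, by simp [S]⟩
  let d : S → ℝ := fun A => Real.sqrt (∑ k with σ k = A, u k ^ 2)
  let e : S → ℝ := fun B => Real.sqrt (∑ k with τ k = B, v k ^ 2)
  -- If the fibre norm vanishes, so does every weight in the fibre, and the convention `x / 0 = 0`
  -- is harmless.
  have hd (i : ι) : u i / d (σ i) * d (σ i) = u i := by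
    refine div_mul_cancel_of_imp fun h0 => ?_
    have h1 := (Real.sqrt_eq_zero (Finset.sum_nonneg fun _ _ => sq_nonneg _)).1 h0
    have h2 := (Finset.sum_eq_zero_iff_of_nonneg fun _ _ => sq_nonneg _).1 h1 i (by simp)
    simpa using h2
  have he (j : κ) : v j / e (τ j) * e (τ j) = v j := by
    refine div_mul_cancel_of_imp fun h0 => ?_
    have h1 := (Real.sqrt_eq_zero (Finset.sum_nonneg fun _ _ => sq_nonneg _)).1 h0
    have h2 := (Finset.sum_eq_zero_iff_of_nonneg fun _ _ => sq_nonneg _).1 h1 j (by simp)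
    simpa using h2
  let M : S → S → ℂ := fun A B => ∑ i with σ i = A, ∑ j with τ j = B,
    h i j * (u i / d (σ i) : ℝ) * (v j / e (τ j) : ℝ)
  have hM (ξ η : S → ℝ) : ‖∑ A, ∑ B, M A B * ξ A * η B‖ ≤
      K * Real.sqrt (∑ A, ξ A ^ 2) * Real.sqrt (∑ B, η B ^ 2) := by
    have e1 : ∑ A, ∑ B, M A B * ξ A * η B = ∑ i, ∑ j, h i j *
        ((u i / d (σ i) * ξ (σ i) : ℝ) : ℂ) * ((v j / e (τ j) * η (τ j) : ℝ) : ℂ) := by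
      simp only [M, Finset.sum_mul]
      rw [sum_sum_fiberwise σ τ fun A B i j => h i j * ((u i / d (σ i) : ℝ) : ℂ) * ((v j / e (τ j) : ℝ) : ℂ)
        * (ξ A : ℂ) * (η B : ℂ)]
      refine Finset.sum_congr rfl fun i _ => Finset.sum_congr rfl fun j _ => ?_
      push_cast; ring
    rw [e1]
    refine (hh _ _).trans ?_
    gcongr K * Real.sqrt ?_ * Real.sqrt ?_
    exacts [sum_sq_fiberwise_le σ u ξ, sum_sq_fiberwise_le τ v η]
  have key := hγ.norm_sum_comp_le S hS d e M hK hM x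
  have e2 : (∑ i, ∑ j, (h i j * u i * v j) • (s i * t j)) x =
      ∑ A : S, (d A : ℂ) • (A : X →L[ℂ] X) (∑ B : S, M A B • (B : X →L[ℂ] X) ((e B : ℂ) • x)) := by
    simp only [M, Finset.sum_smul, map_sum, Finset.smul_sum, map_smul]
    rw [sum_sum_fiberwise σ τ fun A B i j => (d A : ℂ) • (h i j * ((u i / d (σ i) : ℝ) : ℂ) *
      ((v j / e (τ j) : ℝ) : ℂ)) • (e B : ℂ) • (A : X →L[ℂ] X) ((B : X →L[ℂ] X) x)]
    simp only [sum_apply]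
    refine Finset.sum_congr rfl fun i _ => Finset.sum_congr rfl fun j _ => ?_
    simp only [smul_smul, smul_apply, mul_apply_eq_comp, σ, τ]
    congr 1
    conv_lhs => rw [← hd i, ← he j]
    push_cast; ring
  have e3 : ∑ A, d A ^ 2 = ∑ i, u i ^ 2 := by
    rw [← Finset.sum_fiberwise (s := Finset.univ) (g := σ)]
    exact Finset.sum_congr rfl fun A _ => Real.sq_sqrt (Finset.sum_nonneg fun _ _ => sq_nonneg _)
  have e4 : ∑ B, e B ^ 2 = ∑ j, v j ^ 2 := by
    rw [← Finset.sum_fiberwise (s := Finset.univ) (g := τ)]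
    exact Finset.sum_congr rfl fun A _ => Real.sq_sqrt (Finset.sum_nonneg fun _ _ => sq_nonneg _)
  rw [e2]
  rwa [e3, e4] at key

end

/-! ### Hankel matrices and the estimate for a single frequency block. -/

section
open Polynomial ComplexConjugate

theorem IsPrimitiveRoot.sum_pow_mul_conj_pow {m : ℕ} {ζ : ℂ} (hζ : IsPrimitiveRoot ζ m)
    (hm : m ≠ 0) {a b : ℕ} (ha : a < m) (hb : b < m) :
    ∑ t ∈ Finset.range m, (ζ ^ a) ^ t * (conj ζ ^ b) ^ t = if a = b then (m : ℂ) else 0 := by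
  have h1 : ζ * conj ζ = 1 := by
    rw [Complex.mul_conj, Complex.normSq_eq_norm_sq, hζ.norm'_eq_one hm]; simp
  have h1' : conj ζ ^ b * ζ ^ b = 1 := by rw [← mul_pow, mul_comm, h1, one_pow]
  simp_rw [← mul_pow]
  set ω := ζ ^ a * conj ζ ^ b with hω
  split_ifs with hab
  · have : ω = 1 := by rw [hω, hab, mul_comm, h1']
    simp [this]
  · have hne : ω ≠ 1 := fun h => hab <| hζ.pow_inj ha hb <| by
      calc ζ ^ a = ω * ζ ^ b := by rw [hω, mul_assoc, h1', mul_one]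
        _ = ζ ^ b := by rw [h, one_mul]
    have hpow : ω ^ m = 1 := by
      rw [hω, mul_pow, ← pow_mul, ← pow_mul, mul_comm a, mul_comm b, pow_mul, pow_mul,
        ← map_pow, hζ.pow_eq_one]
      simp
    have := mul_geom_sum ω m
    rw [hpow, sub_self] at this
    exact (mul_eq_zero.1 this).resolve_left (sub_ne_zero.2 hne)

/-- Parseval on the cyclic group of order `m`; injectivity of `f` and `f i < m` keep the characters
distinct. -/
theorem IsPrimitiveRoot.sum_sq_norm_eq {m : ℕ} {ζ : ℂ} (hζ : IsPrimitiveRoot ζ m) (hm : m ≠ 0)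
    {ι : Type*} [Fintype ι] (f : ι → ℕ) (hf : Function.Injective f) (hfm : ∀ i, f i < m)
    (ξ : ι → ℝ) :
    ∑ t ∈ Finset.range m, ‖∑ i, (ξ i : ℂ) * (conj ζ ^ f i) ^ t‖ ^ 2 = m * ∑ i, ξ i ^ 2 := by
  classical
  have h : ((∑ t ∈ Finset.range m, ‖∑ i, (ξ i : ℂ) * (conj ζ ^ f i) ^ t‖ ^ 2 : ℝ) : ℂ) =
      ((m * ∑ i, ξ i ^ 2 : ℝ) : ℂ) := by
    push_cast
    simp_rw [← Complex.conj_mul', map_sum, map_mul, map_pow, Complex.conj_conj,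
      Complex.conj_ofReal, Finset.sum_mul_sum]
    rw [Finset.sum_comm, Finset.mul_sum]
    refine Finset.sum_congr rfl fun i _ => ?_
    rw [Finset.sum_comm]
    have (j : ι) : ∑ t ∈ Finset.range m, (ξ i : ℂ) * (ζ ^ f i) ^ t * (ξ j * (conj ζ ^ f j) ^ t) =
        if i = j then (m : ℂ) * ξ i ^ 2 else 0 := by
      have := hζ.sum_pow_mul_conj_pow hm (hfm i) (hfm j)
      simp_rw [mul_mul_mul_comm, ← Finset.mul_sum, this, hf.eq_iff]
      split_ifs with hij
      · subst hij; ring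
      · simp
    simp [this]
  exact_mod_cast h

/-- Hankel matrices of the coefficients of a polynomial are bounded by its supremum on the unit
circle. -/
theorem norm_sum_coeff_mul_le (p : ℂ[X]) {K : ℝ} (hK : 0 ≤ K)
    (hp : ∀ z : ℂ, ‖z‖ = 1 → ‖p.eval z‖ ≤ K) (N L s : ℕ) (ξ : Fin N → ℝ) (η : Fin L → ℝ) :
    ‖∑ i : Fin N, ∑ j : Fin L, p.coeff (i + (j + s)) * ξ i * η j‖ ≤
      K * Real.sqrt (∑ i, ξ i ^ 2) * Real.sqrt (∑ j, η j ^ 2) := by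
  -- So large that no exponent in play wraps around modulo `m`.
  set m := p.natDegree + N + L + s + 1 with hm
  have hm0 : m ≠ 0 := by omega
  have hmpos : (0 : ℝ) < m := by positivity
  have hζ := Complex.isPrimitiveRoot_exp m hm0
  set ζ := Complex.exp (2 * Real.pi * Complex.I / m)
  let a : ℕ → ℂ := fun t => ∑ i : Fin N, (ξ i : ℂ) * (conj ζ ^ (i : ℕ)) ^ t
  let b : ℕ → ℂ := fun t => ∑ j : Fin L, (η j : ℂ) * (conj ζ ^ (j + s : ℕ)) ^ t
  have ha : ∑ t ∈ Finset.range m, ‖a t‖ ^ 2 = m * ∑ i, ξ i ^ 2 :=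
    hζ.sum_sq_norm_eq hm0 (fun i : Fin N => (i : ℕ)) Fin.val_injective (fun i => by omega) ξ
  have hb : ∑ t ∈ Finset.range m, ‖b t‖ ^ 2 = m * ∑ j, η j ^ 2 :=
    hζ.sum_sq_norm_eq hm0 (fun j : Fin L => (j + s : ℕ))
      (fun i j h => Fin.val_injective (by simpa using h)) (fun i => by omega) η
  -- Averaging over the `m`-th roots of unity extracts the coefficient of index `i + (j + s)`;
  -- Cauchy–Schwarz and Parseval then finish.
  have key : ∑ t ∈ Finset.range m, p.eval (ζ ^ t) * a t * b t =
      m * ∑ i : Fin N, ∑ j : Fin L, p.coeff (i + (j + s)) * ξ i * η j := by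
    have e (t : ℕ) : p.eval (ζ ^ t) * a t * b t = ∑ i : Fin N, ∑ j : Fin L, ∑ k ∈ Finset.range m,
        p.coeff k * ξ i * η j * ((ζ ^ k) ^ t * (conj ζ ^ (i + (j + s) : ℕ)) ^ t) := by
      rw [Polynomial.eval_eq_sum_range' (n := m) (by omega)]
      simp only [a, b]
      rw [mul_assoc, Finset.sum_mul_sum, Finset.mul_sum]
      refine Finset.sum_congr rfl fun i _ => ?_
      rw [Finset.mul_sum]
      refine Finset.sum_congr rfl fun j _ => ?_
      rw [Finset.sum_mul]
      refine Finset.sum_congr rfl fun k _ => ?_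
      rw [pow_add (conj ζ) i, mul_pow, ← pow_mul ζ t k, ← pow_mul ζ k t, mul_comm t k]
      ring
    simp_rw [e]
    rw [Finset.sum_comm, Finset.mul_sum]
    refine Finset.sum_congr rfl fun i _ => ?_
    rw [Finset.sum_comm, Finset.mul_sum]
    refine Finset.sum_congr rfl fun j _ => ?_
    rw [Finset.sum_comm]
    have (k : ℕ) (hk : k ∈ Finset.range m) : ∑ t ∈ Finset.range m, p.coeff k * ξ i * η j *
        ((ζ ^ k) ^ t * (conj ζ ^ (i + (j + s) : ℕ)) ^ t) =
        if k = i + (j + s) then m * (p.coeff k * ξ i * η j) else 0 := by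
      rw [← Finset.mul_sum, hζ.sum_pow_mul_conj_pow hm0 (Finset.mem_range.1 hk) (by omega)]
      split_ifs <;> ring
    rw [Finset.sum_congr rfl this, Finset.sum_ite_eq', if_pos (Finset.mem_range.2 (by omega))]
  have hle : (m : ℝ) * ‖∑ i : Fin N, ∑ j : Fin L, p.coeff (i + (j + s)) * ξ i * η j‖ ≤
      m * (K * Real.sqrt (∑ i, ξ i ^ 2) * Real.sqrt (∑ j, η j ^ 2)) := by
    calc (m : ℝ) * ‖∑ i : Fin N, ∑ j : Fin L, p.coeff (i + (j + s)) * ξ i * η j‖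
        = ‖∑ t ∈ Finset.range m, p.eval (ζ ^ t) * a t * b t‖ := by
          rw [key, norm_mul, Complex.norm_natCast]
      _ ≤ ∑ t ∈ Finset.range m, K * (‖a t‖ * ‖b t‖) := by
          refine (norm_sum_le _ _).trans (Finset.sum_le_sum fun t _ => ?_)
          rw [norm_mul, norm_mul, mul_assoc]
          gcongr
          refine hp _ ?_
          rw [norm_pow, hζ.norm'_eq_one hm0, one_pow]
      _ ≤ K * (Real.sqrt (∑ t ∈ Finset.range m, ‖a t‖ ^ 2) *
            Real.sqrt (∑ t ∈ Finset.range m, ‖b t‖ ^ 2)) := by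
          rw [← Finset.mul_sum]
          gcongr
          exact Real.sum_mul_le_sqrt_mul_sqrt _ _ _
      _ = _ := by
          rw [ha, hb, Real.sqrt_mul hmpos.le, Real.sqrt_mul hmpos.le]
          have := Real.mul_self_sqrt hmpos.le
          linear_combination K * Real.sqrt (∑ i, ξ i ^ 2) * Real.sqrt (∑ j, η j ^ 2) * this
  exact le_of_mul_le_mul_left hle hmpos

/-- Each row already sums to `p(T)`: for every `i < N` the window `[i + s, i + s + L)` contains `[N
- 1 + s, L + s)`, outside which the coefficients vanish. -/
theorem natCast_mul_aeval_eq {A : Type*} [Ring A] [Algebra ℂ A] (T : A) (p : ℂ[X]) {N L s : ℕ}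
    (hL : 0 < L) (h1 : ∀ k, k + 1 < N + s → p.coeff k = 0) (h2 : ∀ k, L + s ≤ k → p.coeff k = 0) :
    ∑ i : Fin N, ∑ j : Fin L, p.coeff (i + (j + s)) • T ^ (i + (j + s) : ℕ) =
      (N : ℂ) • aeval T p := by
  have h (i : Fin N) : ∑ j : Fin L, p.coeff (i + (j + s)) • T ^ (i + (j + s) : ℕ) =
      aeval T p := by
    have hdeg : p.natDegree ≤ L + s - 1 :=
      Polynomial.natDegree_le_iff_coeff_eq_zero.2 fun k hk => h2 k (by omega)
    rw [Polynomial.aeval_eq_sum_range' (n := (i + s) + L) (by omega), Finset.sum_range_add,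
      Finset.sum_eq_zero (s := Finset.range (i + s)), zero_add, Finset.sum_range]
    · exact Finset.sum_congr rfl fun j _ => by
        rw [show (i + (j + s) : ℕ) = i + s + j by ring]
    · intro k hk
      have := Finset.mem_range.1 hk
      rw [h1 k (by omega), zero_smul]
  simp_rw [h]
  simp [Nat.cast_smul_eq_nsmul]

variable {X : Type*} [NormedAddCommGroup X] [NormedSpace ℂ X]

/-- The weights `(1 + n)^α` undo the scaling in `scaledPowers`; on the two index ranges `1 + n` is
at most `N` and `L + s`. -/
theorem natCast_mul_norm_aeval_le {T : X →L[ℂ] X} {α γ : ℝ} (hα : 0 ≤ α)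
    (hγ : IsGammaConstant (scaledPowers T α) γ) (p : ℂ[X]) {K : ℝ} (hK : 0 ≤ K)
    (hp : ∀ z : ℂ, ‖z‖ = 1 → ‖p.eval z‖ ≤ K) {N L s : ℕ} (hL : 0 < L)
    (h1 : ∀ k, k + 1 < N + s → p.coeff k = 0) (h2 : ∀ k, L + s ≤ k → p.coeff k = 0) :
    N * ‖aeval T p‖ ≤ 2 * γ ^ 2 * K * (Real.sqrt N * (N : ℝ) ^ α) *
      (Real.sqrt L * ((L : ℝ) + s) ^ α) := by
  have h0 := hγ.1
  have key := hγ.norm_sum_sum_le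
    (fun i : Fin N => (((1 + ((i : ℕ) : ℝ)) ^ (-α) : ℝ) : ℂ) • T ^ (i : ℕ))
    (fun j : Fin L => (((1 + ((j + s : ℕ) : ℝ)) ^ (-α) : ℝ) : ℂ) • T ^ (j + s : ℕ))
    (fun i => ⟨i, rfl⟩) (fun j => ⟨j + s, rfl⟩)
    (fun i => (1 + ((i : ℕ) : ℝ)) ^ α) (fun j => (1 + ((j + s : ℕ) : ℝ)) ^ α)
    (fun i j => p.coeff (i + (j + s))) hK (norm_sum_coeff_mul_le p hK hp N L s)
  have hcancel (n : ℕ) : (1 + (n : ℝ)) ^ α * (1 + (n : ℝ)) ^ (-α) = 1 := by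
    rw [← Real.rpow_add (by positivity)]; simp
  have e : ∑ i : Fin N, ∑ j : Fin L, (p.coeff (i + (j + s)) *
      (((1 + ((i : ℕ) : ℝ)) ^ α : ℝ) : ℂ) * (((1 + ((j + s : ℕ) : ℝ)) ^ α : ℝ) : ℂ)) •
      ((((1 + ((i : ℕ) : ℝ)) ^ (-α) : ℝ) : ℂ) • T ^ (i : ℕ) *
        (((1 + ((j + s : ℕ) : ℝ)) ^ (-α) : ℝ) : ℂ) • T ^ (j + s : ℕ)) = (N : ℂ) • aeval T p := by
    rw [← natCast_mul_aeval_eq T p hL h1 h2]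
    refine Finset.sum_congr rfl fun i _ => Finset.sum_congr rfl fun j _ => ?_
    rw [smul_mul_smul_comm, ← pow_add, smul_smul]
    congr 1
    have ha : ((((1 + ((i : ℕ) : ℝ)) ^ α : ℝ) : ℂ) * (((1 + ((i : ℕ) : ℝ)) ^ (-α) : ℝ) : ℂ)) = 1 := by
      exact_mod_cast congrArg Complex.ofReal (hcancel i)
    have hb : ((((1 + ((j + s : ℕ) : ℝ)) ^ α : ℝ) : ℂ) *
        (((1 + ((j + s : ℕ) : ℝ)) ^ (-α) : ℝ) : ℂ)) = 1 := by
      rw [← Complex.ofReal_mul, hcancel, Complex.ofReal_one]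
    linear_combination (p.coeff (i + (j + s)) * ((((1 + ((j + s : ℕ) : ℝ)) ^ α : ℝ) : ℂ) *
        (((1 + ((j + s : ℕ) : ℝ)) ^ (-α) : ℝ) : ℂ))) * ha + p.coeff (i + (j + s)) * hb
  have bound (n : ℕ) (f : Fin n → ℕ) {r : ℝ} (hr : 0 ≤ r) (hf : ∀ i, 1 + (f i : ℝ) ≤ r) :
      Real.sqrt (∑ i, ((1 + (f i : ℝ)) ^ α) ^ 2) ≤ Real.sqrt n * r ^ α := by
    have : ∑ i, ((1 + (f i : ℝ)) ^ α) ^ 2 ≤ n * (r ^ α) ^ 2 := by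
      refine (Finset.sum_le_card_nsmul _ _ ((r ^ α) ^ 2) fun i _ => ?_).trans_eq (by simp)
      have := hf i
      gcongr
    refine (Real.sqrt_le_sqrt this).trans_eq ?_
    rw [Real.sqrt_mul (by positivity), Real.sqrt_sq (by positivity)]
  rw [e, norm_smul, Complex.norm_natCast] at key
  refine key.trans ?_
  gcongr
  · refine bound N (fun i => i) (by positivity) fun i => ?_
    have := i.2
    exact_mod_cast (by omega : 1 + (i : ℕ) ≤ N)
  · refine bound L (fun j => j + s) (by positivity) fun j => ?_
    have := j.2
    exact_mod_cast (by omega : 1 + (j + s : ℕ) ≤ L + s)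

end

/-! ### Dyadic decomposition of polynomials and the Besov norm. -/

section
open Polynomial

/-- The falling slope of each weight cancels against the rising slope of the next, so partial sums
equal `1` up to `2^m` and then taper off. -/
theorem sum_range_dyadicWeight (m k : ℕ) :
    ∑ n ∈ Finset.range (m + 1), dyadicWeight n k =
      if k ≤ 2 ^ m then 1 else if k ≤ 2 ^ (m + 1) then (2 ^ (m + 1) - (k : ℝ)) / 2 ^ m else 0 := by
  induction m with
  | zero =>
    simp only [zero_add, Finset.sum_range_one, dyadicWeight, pow_zero, pow_one]
    split_ifs with h1 h2
    · rfl
    · obtain rfl : k = 2 := by omega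
      norm_num
    · rfl
  | succ m ih =>
    rw [Finset.sum_range_succ, ih]
    simp only [dyadicWeight]
    have h1 : 2 ^ m < 2 ^ (m + 1) := Nat.pow_lt_pow_right (by norm_num) (by omega)
    have h2 : 2 ^ (m + 1) < 2 ^ (m + 2) := Nat.pow_lt_pow_right (by norm_num) (by omega)
    have h3 : (2 : ℝ) ^ m ≠ 0 := by positivity
    split_ifs <;> first | omega | (field_simp; ring)

theorem dyadicWeight_zero_eq_zero {k : ℕ} (h : 2 ≤ k) : dyadicWeight 0 k = 0 := by
  simp only [dyadicWeight]
  rw [if_neg (by omega)]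

theorem dyadicWeight_succ_eq_zero_of_le {n k : ℕ} (h : k ≤ 2 ^ n) :
    dyadicWeight (n + 1) k = 0 := by
  simp only [dyadicWeight]
  rw [if_pos h]

theorem dyadicWeight_succ_eq_zero_of_lt {n k : ℕ} (h : 4 * 2 ^ n < k) :
    dyadicWeight (n + 1) k = 0 := by
  simp only [dyadicWeight]
  rw [if_neg (by omega), if_neg (by rw [pow_succ]; omega),
    if_neg (by rw [pow_add]; omega)]

/-- The `n`-th dyadic piece of a polynomial, as a polynomial. -/
noncomputable def dyadicPolynomial (n : ℕ) (f : ℂ[X]) : ℂ[X] :=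
  ∑ k ∈ Finset.range (f.natDegree + 1), monomial k ((dyadicWeight n k : ℂ) * f.coeff k)

theorem coeff_dyadicPolynomial (n : ℕ) (f : ℂ[X]) (k : ℕ) :
    (dyadicPolynomial n f).coeff k = (dyadicWeight n k : ℂ) * f.coeff k := by
  rw [dyadicPolynomial, finsetSum_coeff]
  simp only [coeff_monomial]
  rw [Finset.sum_ite_eq']
  split_ifs with h
  · rfl
  · rw [coeff_eq_zero_of_natDegree_lt (by simpa using h), mul_zero]

theorem eval_dyadicPolynomial (n : ℕ) (f : ℂ[X]) :
    (fun z => (dyadicPolynomial n f).eval z) = dyadicPiece n fun k => f.coeff k := by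
  ext z
  rw [dyadicPiece, tsum_eq_sum (s := Finset.range (f.natDegree + 1)), dyadicPolynomial,
    eval_finsetSum]
  · simp
  · intro k hk
    rw [coeff_eq_zero_of_natDegree_lt (by simpa using hk)]; simp

theorem sum_dyadicPolynomial {m : ℕ} {f : ℂ[X]} (h : f.natDegree ≤ 2 ^ m) :
    ∑ n ∈ Finset.range (m + 1), dyadicPolynomial n f = f := by
  ext k
  rw [finsetSum_coeff]
  simp_rw [coeff_dyadicPolynomial]
  rw [← Finset.sum_mul, ← Complex.ofReal_sum, sum_range_dyadicWeight]
  by_cases hk : k ≤ f.natDegree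
  · rw [if_pos (hk.trans h)]; simp
  · rw [coeff_eq_zero_of_natDegree_lt (by omega), mul_zero]

theorem dyadicPolynomial_eq_zero {m n : ℕ} {f : ℂ[X]} (h : f.natDegree ≤ 2 ^ m) (hn : m < n) :
    dyadicPolynomial n f = 0 := by
  ext k
  rw [coeff_dyadicPolynomial]
  by_cases hk : k ≤ f.natDegree
  · obtain ⟨n, rfl⟩ := Nat.exists_eq_succ_of_ne_zero (by omega : n ≠ 0)
    rw [dyadicWeight_succ_eq_zero_of_le ((hk.trans h).trans
      (Nat.pow_le_pow_right (by norm_num) (by omega)))]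
    simp
  · rw [coeff_eq_zero_of_natDegree_lt (by omega)]; simp

theorem discSupNorm_eval_ne_top (p : ℂ[X]) : discSupNorm (fun z => p.eval z) ≠ ∞ := by
  obtain ⟨C, hC⟩ := (isCompact_closedBall (0 : ℂ) 1).exists_bound_of_continuousOn
    p.continuous.continuousOn
  refine ne_top_of_le_ne_top (b := ENNReal.ofReal C) ENNReal.ofReal_ne_top ?_
  refine iSup₂_le fun z hz => ?_
  rw [← ofReal_norm]
  exact ENNReal.ofReal_le_ofReal (hC z (Metric.ball_subset_closedBall hz))

theorem norm_eval_le_discSupNorm (p : ℂ[X]) {z : ℂ} (hz : ‖z‖ = 1) :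
    ‖p.eval z‖ ≤ (discSupNorm fun z => p.eval z).toReal := by
  have hcl : z ∈ closure (Metric.ball (0 : ℂ) 1) := by
    rw [closure_ball _ one_ne_zero]; simp [hz]
  have hclosed : IsClosed {w : ℂ | ‖p.eval w‖ ≤ (discSupNorm fun z => p.eval z).toReal} :=
    isClosed_le p.continuous.norm continuous_const
  refine closure_minimal (fun w hw => ?_) hclosed hcl
  have h : ‖p.eval w‖ₑ ≤ discSupNorm fun z => p.eval z :=
    le_iSup₂ (f := fun (z : ℂ) (_ : z ∈ Metric.ball (0 : ℂ) 1) => ‖p.eval z‖ₑ) w hw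
  have := ENNReal.toReal_mono (discSupNorm_eval_ne_top p) h
  simpa using this

theorem besovNorm_polynomial_eq (s : ℝ) {m : ℕ} {f : ℂ[X]} (h : f.natDegree ≤ 2 ^ m) :
    besovNorm s (fun k => f.coeff k) = ∑ n ∈ Finset.range (m + 1), (2 : ℝ) ^ ((n : ℝ) * s) *
      (discSupNorm fun z => (dyadicPolynomial n f).eval z).toReal := by
  unfold besovNorm besovENorm
  simp_rw [← eval_dyadicPolynomial]
  rw [tsum_eq_sum (s := Finset.range (m + 1)), ENNReal.toReal_sum]
  · refine Finset.sum_congr rfl fun n _ => ?_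
    rw [ENNReal.toReal_mul, ENNReal.toReal_ofReal (by positivity)]
  · exact fun n _ => ENNReal.mul_ne_top ENNReal.ofReal_ne_top (discSupNorm_eval_ne_top _)
  · intro n hn
    rw [dyadicPolynomial_eq_zero h (by simpa using hn)]
    simp [discSupNorm]

variable {X : Type*} [NormedAddCommGroup X] [NormedSpace ℂ X]

theorem norm_aeval_dyadicPolynomial_le {T : X →L[ℂ] X} {α γ : ℝ} (hα : 0 ≤ α)
    (hγ : IsGammaConstant (scaledPowers T α) γ) (f : ℂ[X]) (n : ℕ) :
    ‖aeval T (dyadicPolynomial n f)‖ ≤ 4 * (9 : ℝ) ^ α * γ ^ 2 * ((2 : ℝ) ^ ((n : ℝ) * (2 * α)) *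
      (discSupNorm fun z => (dyadicPolynomial n f).eval z).toReal) := by
  set p := dyadicPolynomial n f with hpdef
  set K := (discSupNorm fun z => p.eval z).toReal
  have hK : 0 ≤ K := ENNReal.toReal_nonneg
  have hp (z : ℂ) (hz : ‖z‖ = 1) : ‖p.eval z‖ ≤ K := norm_eval_le_discSupNorm p hz
  cases n with
  | zero =>
    have key := natCast_mul_norm_aeval_le hα hγ p hK hp (N := 1) (L := 2) (s := 0) (by norm_num)
      (fun k hk => by omega) (fun k hk => by
        rw [hpdef, coeff_dyadicPolynomial, dyadicWeight_zero_eq_zero (by omega)]; simp)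
    have h1 : Real.sqrt 2 ≤ 2 := Real.sqrt_le_iff.2 (by norm_num)
    have h2 : (2 : ℝ) ^ α ≤ 9 ^ α := by gcongr; norm_num
    simp only [Nat.cast_one, one_mul, Real.sqrt_one, Real.one_rpow, mul_one, Nat.cast_ofNat,
      Nat.cast_zero, add_zero] at key
    calc ‖aeval T p‖ ≤ 2 * γ ^ 2 * K * (Real.sqrt 2 * 2 ^ α) := key
      _ ≤ 2 * γ ^ 2 * K * (2 * 9 ^ α) := by gcongr
      _ = _ := by simp; ring
  | succ n =>
    have hN : (0 : ℝ) < 2 ^ n := by positivity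
    -- Piece `n + 1` lives on `2^n < k < 4 * 2^n`. With `s = 1` every window starts no later than
    -- `2^n` and ends no earlier than `4 * 2^n`. As `√L = 2√N`, the factor `√N √L = 2N` absorbs the
    -- `N` on the left.
    have key := natCast_mul_norm_aeval_le hα hγ p hK hp (N := 2 ^ n) (L := 4 * 2 ^ n) (s := 1)
      (by positivity)
      (fun k hk => by
        rw [hpdef, coeff_dyadicPolynomial, dyadicWeight_succ_eq_zero_of_le (by omega)]; simp)
      (fun k hk => by
        rw [hpdef, coeff_dyadicPolynomial, dyadicWeight_succ_eq_zero_of_lt (by omega)]; simp)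
    push_cast at key
    set N : ℝ := 2 ^ n with hNdef
    have hN1 : 1 ≤ N := one_le_pow₀ (by norm_num)
    have e1 : Real.sqrt (4 * N) = 2 * Real.sqrt N := by
      rw [Real.sqrt_mul (by norm_num), show (4 : ℝ) = 2 ^ 2 by norm_num,
        Real.sqrt_sq (by norm_num)]
    have e2 : (2 : ℝ) ^ (((n + 1 : ℕ) : ℝ) * (2 * α)) = ((2 * N) ^ 2) ^ α := by
      rw [← mul_assoc, Real.rpow_mul (by norm_num), hNdef, ← pow_succ', ← pow_mul,
        ← Real.rpow_natCast 2]
      push_cast; rfl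
    -- The bases satisfy `N(4N + 1) ≤ 5N² ≤ 36N² = 9(2N)²`, since `N ≥ 1`.
    have e3 : N ^ α * (4 * N + 1) ^ α ≤ 9 ^ α * ((2 * N) ^ 2) ^ α := by
      rw [← Real.mul_rpow (by positivity) (by positivity),
        ← Real.mul_rpow (by positivity) (by positivity)]
      refine Real.rpow_le_rpow (by positivity) ?_ hα
      nlinarith
    rw [e2]
    refine le_of_mul_le_mul_left ?_ hN
    calc N * ‖aeval T p‖ ≤ _ := key
      _ = N * (4 * γ ^ 2 * K * (N ^ α * (4 * N + 1) ^ α)) := by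
        rw [e1]
        linear_combination 4 * γ ^ 2 * K * (N ^ α * (4 * N + 1) ^ α) * Real.mul_self_sqrt hN.le
      _ ≤ N * (4 * γ ^ 2 * K * (9 ^ α * ((2 * N) ^ 2) ^ α)) := by gcongr
      _ = _ := by ring

end

theorem mainTheorem5 :
    ∃ c : ℝ, 0 ≤ c ∧
      ∀ (X : Type*) [NormedAddCommGroup X] [NormedSpace ℂ X] [CompleteSpace X]
        (T : X →L[ℂ] X) (α : ℝ), 0 ≤ α → IsGammaBounded (scaledPowers T α) →
        ∀ f : Polynomial ℂ,
          ‖Polynomial.aeval T f‖ ≤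
            c * (9 : ℝ) ^ α * gammaBound (scaledPowers T α) ^ 2 *
              besovNorm (2 * α) (fun k => f.coeff k) := by
  refine ⟨4, by norm_num, fun X _ _ _ T α hα h f => ?_⟩
  have hγ := h.isGammaConstant_gammaBound
  -- Any `m` with `f.natDegree ≤ 2 ^ m` would do, since later pieces vanish; `m = f.natDegree` is a
  -- crude choice.
  have hdeg : f.natDegree ≤ 2 ^ f.natDegree := Nat.lt_two_pow_self.le
  rw [besovNorm_polynomial_eq _ hdeg, Finset.mul_sum]
  nth_rw 1 [← sum_dyadicPolynomial hdeg]
  rw [map_sum]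
  exact (norm_sum_le _ _).trans
    (Finset.sum_le_sum fun n _ => norm_aeval_dyadicPolynomial_le hα hγ f n)
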